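/- For $x\in\mathbb{R}^2$, $r>0$, $0<\alpha<1$ and a line $\ell\in G(2,1)$ through the origin (a one-dimensional linear subspace of $\mathbb{R}^2$), let $$X(x,r,\ell,\alpha)=\{y\in\mathbb{R}^2 : |y-x|\le r,\ \operatorname{dist}(y-x,\ell)<\alpha|y-x|\}.$$ Let $\mathcal{H}^1$ be the one-dimensional Hausdorff measure on $\mathbb{R}^2$. A set $E\subset\mathbb{R}^2$ is $1$-rectifiable if there are Lipschitz maps $f_i\colon\mathbb{R}\to\mathbb{R}^2$, $i\in\mathbb{N}$, with $\mathcal{H}^1\bigl(E\setminus\bigcup_i f_i(\mathbb{R})\bigr)=0$, and a set $A\subset\mathbb{R}^2$ is purely $1$-unrectifiable if $\mathcal{H}^1(A\cap E)=0$ for every $1$-rectifiable set $E\subset\mathbb{R}^2$. There exists a purely $1$-unrectifiable compact set $A\subset\mathbb{R}^2$ with $0<\mathcal{H}^1(A)<\infty$ such that for every $0<\alpha<1$ and every $x\in A$ $$\lim_{r\downarrow 0}\ \inf_{\ell\in G(2,1)}\frac{\mathcal{H}^1\bigl(A\cap X(x,r,\ell,\alpha)\bigr)}{2r}=0.$$ In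 particular, for this set $A$ there are no $0<\alpha<1$ and $c>0$ such that $$\limsup_{r\downarrow 0}\ \inf_{\ell\in G(2,1)}\frac{\mathcal{H}^1\bigl(A\cap X(x,r,\ell,\alpha)\bigr)}{2r}>c\quad\text{for }\mathcal{H}^1\text{-almost all }x\in A.$$ -/

import Mathlib

open Set Filter Topology MeasureTheory

/-- The cone `X(x, r, V, α) = {y ∈ B(x, r) : dist (y - x, V) < α |y - x|}`, where `B(x, r)` is the
closed ball of radius `r` centred at `x`. -/
def cone {n : ℕ} (x : EuclideanSpace ℝ (Fin n)) (r : ℝ)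
    (V : Submodule ℝ (EuclideanSpace ℝ (Fin n))) (α : ℝ) : Set (EuclideanSpace ℝ (Fin n)) :=
  Metric.closedBall x r ∩
    {y | Metric.infDist (y - x) (V : Set (EuclideanSpace ℝ (Fin n))) < α * ‖y - x‖}

/-- `G(n, k)`: the set of all `k`-dimensional linear subspaces of `ℝⁿ`. -/
def linSubspaces (n k : ℕ) : Set (Submodule ℝ (EuclideanSpace ℝ (Fin n))) :=
  {V | Module.finrank ℝ V = k}

/-- A set `E ⊆ ℝⁿ` is `m`-rectifiable if `ℋᵐ`-almost all of it is covered by countably many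
Lipschitz images of `ℝᵐ`. -/
def IsRectifiableSet {n : ℕ} (m : ℕ) (E : Set (EuclideanSpace ℝ (Fin n))) : Prop :=
  ∃ f : ℕ → EuclideanSpace ℝ (Fin m) → EuclideanSpace ℝ (Fin n),
    (∀ i, ∃ K : NNReal, LipschitzWith K (f i)) ∧
      Measure.hausdorffMeasure (m : ℝ) (E \ ⋃ i, range (f i)) = 0

/-- A set `A ⊆ ℝⁿ` is purely `m`-unrectifiable if it meets every `m`-rectifiable set in an
`ℋᵐ`-null set. -/
def IsPurelyUnrectifiable {n : ℕ} (m : ℕ) (A : Set (EuclideanSpace ℝ (Fin n))) : Prop :=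
  ∀ E : Set (EuclideanSpace ℝ (Fin n)), IsRectifiableSet m E →
    Measure.hausdorffMeasure (m : ℝ) (A ∩ E) = 0

/-- `inf_{V ∈ G(n, n-m)} ℋᵐ(A ∩ X(x, r, V, α)) / (2r)ᵐ`, as an extended nonnegative number.
It is only meaningful for `m ≤ n` and `r > 0`. -/
noncomputable def infConeRatio {n : ℕ} (m : ℕ) (A : Set (EuclideanSpace ℝ (Fin n))) (α : ℝ)
    (x : EuclideanSpace ℝ (Fin n)) (r : ℝ) : ENNReal :=
  ⨅ V ∈ linSubspaces n (n - m),
    Measure.hausdorffMeasure (m : ℝ) (A ∩ cone x r V α) / ENNReal.ofReal ((2 * r) ^ m)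

/-!
Start from the unit interval and, at stage `n + 1`, cut every segment into a large number of equal
cells and rotate these about their midpoints, alternately by `θₙ` and `-θₙ`, where
`cos θₙ = (n + 1) / (n + 2)`. Neighbourhoods of the endpoints of the cells, of small total length,
are removed from the parameter interval, which makes the inverse of the limit parametrization
Lipschitz.

Since `θₙ → 0`, the limit set is asymptotically flat: within a radius between the sizes of the gaps
of generations `n + 1` and `n`, a point sees everything outside its own far smaller cell of
generation `n + 2` nearly in the direction of its segment of generation `n`. The cone around the
line orthogonal to this segment therefore contains only that cell.

Since the product of the cosines vanishes, the mean over any cell of the directions of a much later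
generation is nearly zero, so the directions diverge at almost every parameter. If a Lipschitz curve
met the limit set in positive measure, the parametrization would agree with a Lipschitz function on
a set of parameters of positive measure, and at almost every point of it the directions would
converge to the derivative of this function.
-/

namespace ZigzagCantor

/-! ### Lipschitz curves and sets of vanishing Hausdorff measure -/

section LipschitzPieces

open Module (finrank)

variable {E : Type*} [NormedAddCommGroup E] [NormedSpace ℝ E] [FiniteDimensional ℝ E]

lemma exists_antilipschitz_of_approximatesLinearOn (A : E →L[ℝ] E) :
    ∃ c : NNReal, c ≠ 0 ∧ (A.det ≠ 0 → ∀ (f : E → E) (s : Set E), ApproximatesLinearOn f A s c →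
      ∃ K, AntilipschitzWith K (s.domRestrict f)) := by
  by_cases hA : A.det = 0
  · exact ⟨1, one_ne_zero, fun h => absurd hA h⟩
  obtain ⟨e, rfl⟩ : ∃ e : E ≃L[ℝ] E, (e : E →L[ℝ] E) = A :=
    ⟨_, A.coe_toContinuousLinearEquivOfDetNeZero hA⟩
  rcases e.subsingleton_or_nnnorm_symm_pos with hE | he
  · exact ⟨1, one_ne_zero, fun _ _ _ h => ⟨_, h.antilipschitz (Or.inl hE)⟩⟩
  · have hpos : 0 < ‖(e.symm : E →L[ℝ] E)‖₊⁻¹ := inv_pos.2 he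
    exact ⟨_, (half_pos hpos).ne', fun _ _ _ h => ⟨_, h.antilipschitz (Or.inr (half_lt_self hpos))⟩⟩

variable [MeasurableSpace E] [BorelSpace E]

lemma exists_antilipschitz_cover_of_det_ne_zero {f : E → E} {f' : E → E →L[ℝ] E} {s : Set E}
    (hf : ∀ x ∈ s, HasFDerivAt f (f' x) x) (hdet : ∀ x ∈ s, (f' x).det ≠ 0) :
    ∃ t : ℕ → Set E, s ⊆ ⋃ k, t k ∧ ∀ k, ∃ K, AntilipschitzWith K ((t k).domRestrict f) := by
  rcases s.eq_empty_or_nonempty with rfl | hs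
  · exact ⟨fun _ => ∅, empty_subset _, fun _ => ⟨0, fun x => x.2.elim⟩⟩
  choose c hc hanti using exists_antilipschitz_of_approximatesLinearOn (E := E)
  obtain ⟨t, A, -, -, hst, happrox, hA⟩ :=
    exists_partition_approximatesLinearOn_of_hasFDerivWithinAt f s f'
      (fun x hx => (hf x hx).hasFDerivWithinAt) c hc
  refine ⟨fun k => s ∩ t k, fun x hx => ?_, fun k => ?_⟩
  · simpa [hx] using hst hx
  obtain ⟨y, hy, hAy⟩ := hA hs k
  exact hanti (A k) (hAy ▸ hdet y hy) f _ (happrox k)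

/-- By Rademacher's theorem and Sard's lemma the points at which `f` is not differentiable with an
invertible derivative have null image. -/
lemma exists_antilipschitz_cover {f : E → E} {C : NNReal} (hf : LipschitzWith C f) :
    ∃ t : ℕ → Set E, (∀ k, ∃ K, AntilipschitzWith K ((t k).domRestrict f)) ∧
      μH[finrank ℝ E] (f '' (⋃ k, t k)ᶜ) = 0 := by
  have : (μH[finrank ℝ E] : Measure E).IsAddHaarMeasure := isAddHaarMeasure_hausdorffMeasure
  set D := {x | DifferentiableAt ℝ f x}
  obtain ⟨t, hst, ht⟩ := exists_antilipschitz_cover_of_det_ne_zero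
    (s := {x ∈ D | (fderiv ℝ f x).det ≠ 0}) (fun x hx => hx.1.hasFDerivAt) fun x hx => hx.2
  refine ⟨t, ht, ?_⟩
  have hnondiff : μH[finrank ℝ E] (f '' Dᶜ) = 0 := by
    have hD : μH[finrank ℝ E] Dᶜ = 0 := ae_iff.1 hf.ae_differentiableAt
    have himage := hf.hausdorffMeasure_image_le (finrank ℝ E).cast_nonneg Dᶜ
    rwa [hD, mul_zero, nonpos_iff_eq_zero] at himage
  have hcrit : μH[finrank ℝ E] (f '' {x ∈ D | (fderiv ℝ f x).det = 0}) = 0 :=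
    addHaar_image_eq_zero_of_det_fderivWithin_eq_zero _
      (fun x hx => hx.1.hasFDerivAt.hasFDerivWithinAt) fun x hx => hx.2
  refine measure_mono_null ?_ (measure_union_null hnondiff hcrit)
  rw [← image_union]
  refine image_mono fun x hx => ?_
  by_cases hxD : x ∈ D
  · exact Or.inr ⟨hxD, by_contra fun hdet => hx (hst ⟨hxD, hdet⟩)⟩
  · exact Or.inl hxD

/-- The parameters `h (g u)` of the common points are split into countably many pieces on which
`h ∘ g` is bi-Lipschitz, so that `φ = g ∘ (h ∘ g)⁻¹` is Lipschitz there, and a set with null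
image. -/
lemma hausdorffMeasure_image_inter_range_eq_zero {X : Type*} [MetricSpace X] [MeasurableSpace X]
    [BorelSpace X] {φ g : E → X} {h : X → E} {P : Set E}
    {L C : NNReal} (hh : LipschitzWith L h) (hφ : LeftInvOn h φ P)
    (hnull : ∀ Z, μH[finrank ℝ E] Z = 0 → μH[finrank ℝ E] (φ '' Z) = 0)
    (hlip : ∀ T K, LipschitzOnWith K φ T → μH[finrank ℝ E] T = 0) (hg : LipschitzWith C g) :
    μH[finrank ℝ E] (φ '' P ∩ range g) = 0 := by
  obtain ⟨t, ht, hcompl⟩ := exists_antilipschitz_cover (hh.comp hg)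
  set S := g ⁻¹' (φ '' P)
  have hφg : ∀ u ∈ S, φ (h (g u)) = g u := by
    rintro u ⟨x, hx, hxu⟩
    rw [← hxu, hφ hx]
  have hpiece (k : ℕ) : μH[finrank ℝ E] (h ∘ g '' (S ∩ t k)) = 0 := by
    obtain ⟨K, hK⟩ := ht k
    refine hlip _ (C * K) ?_
    rintro _ ⟨a, ⟨haS, hat⟩, rfl⟩ _ ⟨b, ⟨hbS, hbt⟩, rfl⟩
    rw [Function.comp_apply, Function.comp_apply, hφg a haS, hφg b hbS, ENNReal.coe_mul, mul_assoc]
    exact (hg a b).trans (mul_le_mul_right (hK ⟨a, hat⟩ ⟨b, hbt⟩) _)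
  refine measure_mono_null ?_ (hnull _ (measure_union_null (measure_iUnion_null hpiece) hcompl))
  rintro _ ⟨hy, u, rfl⟩
  refine ⟨h (g u), ?_, hφg u hy⟩
  by_cases hu : u ∈ ⋃ k, t k
  · obtain ⟨k, hk⟩ := mem_iUnion.1 hu
    exact Or.inl (mem_iUnion.2 ⟨k, u, ⟨hy, hk⟩, rfl⟩)
  · exact Or.inr ⟨u, hu, rfl⟩

end LipschitzPieces

lemma isPurelyUnrectifiable_of_lipschitz_range {n m : ℕ} {A : Set (EuclideanSpace ℝ (Fin n))}
    (hA : ∀ (f : EuclideanSpace ℝ (Fin m) → EuclideanSpace ℝ (Fin n)) (K : NNReal),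
      LipschitzWith K f → μH[m] (A ∩ range f) = 0) :
    IsPurelyUnrectifiable m A := by
  rintro E ⟨f, hf, hE⟩
  choose K hK using hf
  have hnull := measure_union_null hE (measure_iUnion_null fun i => hA (f i) (K i) (hK i))
  rw [← inter_iUnion] at hnull
  refine measure_mono_null (fun x hx => ?_) hnull
  by_cases hxf : x ∈ ⋃ i, range (f i)
  · exact Or.inr ⟨hx.1, hxf⟩
  · exact Or.inl ⟨hx.2, hxf⟩

/-! ### The triangle wave, orthogonal complements and integrals -/

/-- Both sides are the triangle wave of slope `± 1` and period `2`. -/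
lemma neg_one_zpow_floor_mul_fract_sub_half (x : ℝ) :
    (-1 : ℝ) ^ ⌊x⌋ * (Int.fract x - 1 / 2) = ‖(x : AddCircle (2 : ℝ))‖ - 1 / 2 := by
  have hx := Int.floor_add_fract x
  have h0 := Int.fract_nonneg x
  have h1 := (Int.fract_lt_one x).le
  have hnorm {y : ℝ} (hy : |y| ≤ 1) : ‖(y : AddCircle (2 : ℝ))‖ = |y| :=
    (AddCircle.norm_coe_eq_abs_iff 2 two_ne_zero).2 (by simpa using hy)
  rcases Int.even_or_odd' ⌊x⌋ with ⟨k, hk | hk⟩ <;> rw [hk] at hx ⊢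
  · have hcoe : (x : AddCircle (2 : ℝ)) = (Int.fract x : ℝ) := by
      rw [← sub_eq_zero, ← AddCircle.coe_sub, AddCircle.coe_eq_zero_iff]
      exact ⟨k, by push_cast at hx; rw [zsmul_eq_mul]; linarith⟩
    rw [hcoe, hnorm (by rwa [abs_of_nonneg h0]), abs_of_nonneg h0, (even_two_mul k).neg_one_zpow,
      one_mul]
  · have hcoe : (x : AddCircle (2 : ℝ)) = (Int.fract x - 1 : ℝ) := by
      rw [← sub_eq_zero, ← AddCircle.coe_sub, AddCircle.coe_eq_zero_iff]
      exact ⟨k + 1, by push_cast at hx ⊢; rw [zsmul_eq_mul]; push_cast; linarith⟩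
    have h1' : Int.fract x - 1 ≤ 0 := sub_nonpos.2 h1
    rw [hcoe, hnorm (by rw [abs_of_nonpos h1']; linarith), abs_of_nonpos h1',
      (odd_two_mul_add_one k).neg_one_zpow]
    ring

lemma abs_neg_one_zpow_floor_mul_sub_le (x y : ℝ) :
    |(-1 : ℝ) ^ ⌊x⌋ * (Int.fract x - 1 / 2) - (-1 : ℝ) ^ ⌊y⌋ * (Int.fract y - 1 / 2)| ≤
      |x - y| := by
  rw [neg_one_zpow_floor_mul_fract_sub_half, neg_one_zpow_floor_mul_fract_sub_half,
    sub_sub_sub_cancel_right]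
  refine (abs_norm_sub_norm_le _ _).trans ?_
  rw [← AddCircle.coe_sub]
  exact QuotientAddGroup.norm_mk_le_norm

lemma abs_inner_le_infDist_orthogonal {E : Type*} [NormedAddCommGroup E] [InnerProductSpace ℝ E]
    {u : E} (hu : ‖u‖ = 1) (z : E) :
    |inner ℝ u z| ≤ Metric.infDist z ((ℝ ∙ u)ᗮ : Submodule ℝ E) := by
  refine (Metric.le_infDist ⟨0, Submodule.zero_mem _⟩).2 fun v hv => ?_
  have huv : inner ℝ u v = 0 := Submodule.mem_orthogonal_singleton_iff_inner_right.1 hv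
  calc |inner ℝ u z| = |inner ℝ u (z - v)| := by rw [inner_sub_right, huv, sub_zero]
    _ ≤ dist z v := by simpa [hu, dist_eq_norm] using abs_real_inner_le_norm u (z - v)

lemma orthogonal_span_singleton_mem_linSubspaces {n : ℕ}
    {v : EuclideanSpace ℝ (Fin (n + 1))} (hv : v ≠ 0) : (ℝ ∙ v)ᗮ ∈ linSubspaces (n + 1) n := by
  have : Fact (Module.finrank ℝ (EuclideanSpace ℝ (Fin (n + 1))) = n + 1) := ⟨by simp⟩
  exact Submodule.finrank_orthogonal_span_singleton hv

lemma norm_setIntegral_le_of_norm_le_of_norm_le {α G : Type*} [MeasurableSpace α]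
    [NormedAddCommGroup G] [NormedSpace ℝ G] {μ : Measure α} {f : α → G} {I S : Set α} {a b : ℝ}
    (hS : MeasurableSet S) (hI : μ I ≠ ⊤) (hf : IntegrableOn f I μ)
    (ha : ∀ x ∈ I ∩ S, ‖f x‖ ≤ a) (hb : ∀ x ∈ I \ S, ‖f x‖ ≤ b) :
    ‖∫ x in I, f x ∂μ‖ ≤ a * μ.real (I ∩ S) + b * μ.real (I \ S) := by
  rw [← integral_inter_add_sdiff hS hf]
  refine (norm_add_le _ _).trans (add_le_add ?_ ?_)
  · exact norm_setIntegral_le_of_norm_le_const (measure_inter_lt_top_of_left_ne_top hI) ha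
  · exact norm_setIntegral_le_of_norm_le_const ((measure_mono sdiff_subset).trans_lt hI.lt_top) hb

lemma exists_succ_le_lt_of_tendsto_zero {u : ℕ → ℝ} (hu : Tendsto u atTop (𝓝 0)) {n₀ : ℕ} {r : ℝ}
    (hr : 0 < r) (hr₀ : r < u n₀) : ∃ n ≥ n₀, u (n + 1) ≤ r ∧ r < u n := by
  obtain ⟨N, hN⟩ := eventually_atTop.1 (hu.eventually_le_const hr)
  by_contra! h
  have hlt : ∀ n ≥ n₀, r < u n := fun n hn =>
    Nat.le_induction hr₀ (fun k hk ih => lt_of_not_ge fun hle => (h k hk hle).not_gt ih) n hn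
  exact (hN (max N n₀) (le_max_left _ _)).not_gt (hlt _ (le_max_right _ _))

/-! ### The zigzag curve -/

/-- The number of cells of generation `n` in the unit interval. -/
def scale (n : ℕ) : ℕ := 8 ^ n ^ 2

/-- The radius, relative to the length of a cell, of the neighbourhoods of the endpoints of the
cells of generation `n` that are removed from the parameter interval. -/
noncomputable def gap (n : ℕ) : ℝ := (1 / 2) ^ (n + 4)

/-- The cosine of the turning angle `θₙ` between generations `n` and `n + 1`. It is chosen so that
`θₙ → 0`, while the product of all cosines vanishes. -/
noncomputable def cosTurn (n : ℕ) : ℝ := (n + 1) / (n + 2)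

/-- The sine of the turning angle between generations `n` and `n + 1`. -/
noncomputable def sinTurn (n : ℕ) : ℝ := √(1 - cosTurn n ^ 2)

/-- The length `2 sin (θₙ / 2)` of the chord of the turning angle between generations `n` and
`n + 1`. -/
noncomputable def chord (n : ℕ) : ℝ := √(2 / (n + 2))

/-- The index of the cell of generation `n` containing `t`. -/
noncomputable def cell (n : ℕ) (t : ℝ) : ℤ := ⌊scale n * t⌋

/-- The rotation applied at `t` between generations `n` and `n + 1`. -/
noncomputable def turn (n : ℕ) (t : ℝ) : ℂ := ⟨cosTurn n, (-1) ^ cell (n + 1) t * sinTurn n⟩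

/-- The direction of the segment of generation `n` at the parameter `t`. -/
noncomputable def dir : ℕ → ℝ → ℂ
  | 0, _ => 1
  | n + 1, t => dir n t * turn n t

/-- The signed distance from the centre of the cell of generation `n` containing `t` to `t`. -/
noncomputable def offset (n : ℕ) (t : ℝ) : ℝ := t - (cell n t + 1 / 2) / scale n

/-- The parametrization of the union of the segments of generation `n`: each segment of generation
`n + 1` arises by rotating a piece of a segment of generation `n` about its midpoint. -/
noncomputable def approx : ℕ → ℝ → ℂ
  | 0, t => t
  | n + 1, t => approx n t + offset (n + 1) t * (dir (n + 1) t - dir n t)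

/-- The limit of the parametrizations `approx n`. -/
noncomputable def zigzag (t : ℝ) : ℂ := limUnder atTop fun n => approx n t

/-- The parameters that stay away from the endpoints of the cells of all generations. -/
def params : Set ℝ :=
  {t | t ∈ Icc (0 : ℝ) 1 ∧ ∀ (n : ℕ) (j : ℤ), gap n ≤ |scale n * t - j|}

variable {m n : ℕ} {s t : ℝ}

lemma scale_pos (n : ℕ) : (0 : ℝ) < scale n := by
  simp [scale]

lemma scale_zero : scale 0 = 1 := by
  simp [scale]

lemma scale_succ (n : ℕ) : scale (n + 1) = scale n * 8 ^ (2 * n + 1) := by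
  rw [scale, scale, ← pow_add, add_sq, mul_one, one_pow, add_assoc]

lemma two_pow_mul_scale_le (n k : ℕ) : (2 : ℝ) ^ k * scale n ≤ scale (n + k) := by
  have hexp : k + n ^ 2 ≤ (n + k) ^ 2 := by nlinarith [Nat.le_mul_self k, Nat.zero_le (n * k)]
  calc (2 : ℝ) ^ k * scale n ≤ 8 ^ k * 8 ^ n ^ 2 := by
        push_cast [scale]
        gcongr
        norm_num
    _ = 8 ^ (k + n ^ 2) := (pow_add _ _ _).symm
    _ ≤ 8 ^ (n + k) ^ 2 := pow_le_pow_right₀ (by norm_num) hexp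
    _ = scale (n + k) := by push_cast [scale]; rfl

lemma two_pow_le_scale (n : ℕ) : (2 : ℝ) ^ n ≤ scale n := by
  simpa [scale_zero] using two_pow_mul_scale_le 0 n

lemma tendsto_inv_scale : Tendsto (fun n => (scale n : ℝ)⁻¹) atTop (𝓝 0) :=
  tendsto_inv_atTop_zero.comp <|
    tendsto_atTop_mono two_pow_le_scale (tendsto_pow_atTop_atTop_of_one_lt one_lt_two)

lemma gap_pos (n : ℕ) : 0 < gap n := by
  unfold gap
  positivity

lemma gap_le (n : ℕ) : gap n ≤ 1 / 16 :=
  (pow_le_pow_of_le_one (by norm_num) (by norm_num) (Nat.le_add_left 4 n)).trans_eq (by norm_num)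

lemma inv_scale_add_two_le (n : ℕ) :
    (scale (n + 2) : ℝ)⁻¹ ≤ gap n * (gap (n + 1) / scale (n + 1)) := by
  have hpow : ((8 : ℝ) ^ (2 * (n + 1) + 1))⁻¹ ≤ gap n * gap (n + 1) := by
    rw [gap, gap, ← pow_add, one_div, inv_pow, show (8 : ℝ) = 2 ^ 3 by norm_num, ← pow_mul]
    gcongr
    · exact one_le_two
    · omega
  rw [scale_succ, Nat.cast_mul, mul_inv, mul_comm, ← mul_div_assoc, div_eq_mul_inv, Nat.cast_pow]
  exact mul_le_mul_of_nonneg_right hpow (inv_pos.2 (scale_pos _)).le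

lemma chord_nonneg (n : ℕ) : 0 ≤ chord n := Real.sqrt_nonneg _

lemma chord_sq (n : ℕ) : chord n ^ 2 = 2 / (n + 2) := Real.sq_sqrt (by positivity)

lemma chord_antitone : Antitone chord := fun m n h => by
  unfold chord
  gcongr

lemma chord_le_one (n : ℕ) : chord n ≤ 1 := by
  refine Real.sqrt_le_one.2 ((div_le_one (by positivity)).2 ?_)
  linarith [n.cast_nonneg (α := ℝ)]

lemma tendsto_chord : Tendsto chord atTop (𝓝 0) := by
  have hquot : Tendsto (fun n : ℕ => (2 : ℝ) / (n + 2)) atTop (𝓝 0) :=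
    tendsto_const_nhds.div_atTop
      (tendsto_atTop_add_const_right _ _ tendsto_natCast_atTop_atTop)
  have hsqrt := (Real.continuous_sqrt.tendsto 0).comp hquot
  rwa [Real.sqrt_zero] at hsqrt

lemma cosTurn_eq (n : ℕ) : cosTurn n = 1 - chord n ^ 2 / 2 := by
  rw [chord_sq, cosTurn]
  field_simp
  ring

lemma half_le_cosTurn (n : ℕ) : 1 / 2 ≤ cosTurn n := by
  have hsq : chord n ^ 2 ≤ 1 := pow_le_one₀ (chord_nonneg n) (chord_le_one n)
  rw [cosTurn_eq]
  linarith

lemma cosTurn_le_one (n : ℕ) : cosTurn n ≤ 1 := by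
  rw [cosTurn_eq]
  linarith [sq_nonneg (chord n)]

lemma sinTurn_nonneg (n : ℕ) : 0 ≤ sinTurn n := Real.sqrt_nonneg _

lemma sinTurn_sq (n : ℕ) : sinTurn n ^ 2 = 1 - cosTurn n ^ 2 :=
  Real.sq_sqrt (by nlinarith [half_le_cosTurn n, cosTurn_le_one n])

lemma sinTurn_le_chord (n : ℕ) : sinTurn n ≤ chord n := by
  refine le_of_sq_le_sq ?_ (chord_nonneg n)
  rw [sinTurn_sq, cosTurn_eq]
  nlinarith [sq_nonneg (chord n ^ 2)]

lemma norm_turn (n : ℕ) (t : ℝ) : ‖turn n t‖ = 1 := by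
  have hsign : ((-1 : ℝ) ^ cell (n + 1) t) ^ 2 = 1 := by
    rw [← zpow_natCast, zpow_comm]
    simp
  rw [← sq_eq_sq₀ (norm_nonneg _) zero_le_one, Complex.sq_norm, Complex.normSq_apply, turn]
  linear_combination sinTurn n ^ 2 * hsign + sinTurn_sq n

lemma norm_turn_sub_one (n : ℕ) (t : ℝ) : ‖turn n t - 1‖ = chord n := by
  have hsq := Complex.sq_norm (turn n t)
  rw [norm_turn, Complex.normSq_apply] at hsq
  rw [← sq_eq_sq₀ (norm_nonneg _) (chord_nonneg n), Complex.sq_norm, Complex.normSq_apply,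
    Complex.sub_re, Complex.sub_im, Complex.one_re, Complex.one_im]
  have hre : (turn n t).re = 1 - chord n ^ 2 / 2 := cosTurn_eq n
  linear_combination -hsq - 2 * hre

lemma norm_dir (n : ℕ) (t : ℝ) : ‖dir n t‖ = 1 := by
  induction n with
  | zero => simp [dir]
  | succ n ih => rw [dir, norm_mul, ih, norm_turn, one_mul]

lemma dir_ne_zero (n : ℕ) (t : ℝ) : dir n t ≠ 0 :=
  norm_ne_zero_iff.1 (by rw [norm_dir]; exact one_ne_zero)

lemma norm_dir_succ_sub (n : ℕ) (t : ℝ) : ‖dir (n + 1) t - dir n t‖ = chord n := by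
  rw [dir, ← mul_sub_one, norm_mul, norm_dir, one_mul, norm_turn_sub_one]

lemma offset_eq (n : ℕ) (t : ℝ) : offset n t = (Int.fract (scale n * t) - 1 / 2) / scale n := by
  have := (scale_pos n).ne'
  rw [offset, cell, Int.fract]
  field_simp
  ring

lemma abs_offset_le (n : ℕ) (t : ℝ) : |offset n t| ≤ 1 / 2 / scale n := by
  rw [offset_eq, abs_div, abs_of_pos (scale_pos n)]
  gcongr
  rw [abs_le]
  constructor <;> linarith [Int.fract_nonneg (scale n * t), Int.fract_lt_one (scale n * t)]

lemma norm_approx_succ_sub_le (n : ℕ) (t : ℝ) :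
    ‖approx (n + 1) t - approx n t‖ ≤ chord n * (1 / 2 / scale (n + 1)) := by
  rw [approx, add_sub_cancel_left, norm_mul, norm_dir_succ_sub, Complex.norm_real,
    Real.norm_eq_abs, mul_comm]
  exact mul_le_mul_of_nonneg_left (abs_offset_le _ _) (chord_nonneg n)

lemma dist_approx_add_le (n k : ℕ) (t : ℝ) :
    dist (approx (n + k) t) (approx (n + (k + 1)) t) ≤
      chord n * (1 / 2 / scale (n + 1)) * (1 / 2) ^ k := by
  have hscale : (2 : ℝ) ^ k * scale (n + 1) ≤ scale (n + k + 1) := by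
    simpa [add_right_comm] using two_pow_mul_scale_le (n + 1) k
  have hpos := scale_pos (n + 1)
  rw [dist_comm, dist_eq_norm, ← add_assoc]
  calc ‖approx (n + k + 1) t - approx (n + k) t‖
      ≤ chord (n + k) * (1 / 2 / scale (n + k + 1)) := norm_approx_succ_sub_le _ t
    _ ≤ chord n * (1 / 2 / (2 ^ k * scale (n + 1))) := by
        gcongr
        · exact chord_nonneg n
        · exact chord_antitone (Nat.le_add_right n k)
    _ = chord n * (1 / 2 / scale (n + 1)) * (1 / 2) ^ k := by
        rw [one_div_pow]
        field_simp

lemma tendsto_approx (t : ℝ) : Tendsto (fun n => approx n t) atTop (𝓝 (zigzag t)) := by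
  refine (cauchySeq_of_le_geometric (1 / 2) (chord 0 * (1 / 2 / scale (0 + 1))) (by norm_num)
    fun k => ?_).tendsto_limUnder
  simpa only [zero_add] using dist_approx_add_le 0 k t

lemma norm_zigzag_sub_approx_le (n : ℕ) (t : ℝ) :
    ‖zigzag t - approx n t‖ ≤ chord n / scale (n + 1) := by
  have hshift : Tendsto (fun k => approx (n + k) t) atTop (𝓝 (zigzag t)) := by
    simpa [add_comm, Function.comp_def] using (tendsto_approx t).comp (tendsto_add_atTop_nat n)
  have hdist := dist_le_of_le_geometric_of_tendsto₀ (1 / 2) (chord n * (1 / 2 / scale (n + 1)))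
    (by norm_num) (fun k => dist_approx_add_le n k t) hshift
  rw [dist_comm, dist_eq_norm, add_zero] at hdist
  exact hdist.trans_eq (by ring)

/-! ### Points with common cells -/

lemma cell_mono (n : ℕ) : Monotone (cell n) := fun _ _ h =>
  Int.floor_mono (mul_le_mul_of_nonneg_left h (scale_pos n).le)

lemma cell_eq_ediv (n : ℕ) (t : ℝ) : cell n t = cell (n + 1) t / (8 ^ (2 * n + 1) : ℕ) := by
  rw [cell, cell, ← Int.floor_div_natCast, scale_succ]
  push_cast
  congr 1
  field_simp

lemma cell_eq_of_le (h : cell n s = cell n t) (hmn : m ≤ n) : cell m s = cell m t := by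
  induction n, hmn using Nat.le_induction with
  | base => exact h
  | succ n _ ih => exact ih (by rw [cell_eq_ediv, h, ← cell_eq_ediv])

lemma abs_sub_lt_of_cell_eq (h : cell n s = cell n t) : |s - t| < (scale n : ℝ)⁻¹ := by
  have hfloor := Int.abs_sub_lt_one_of_floor_eq_floor h
  rwa [← mul_sub, abs_mul, abs_of_pos (scale_pos n), ← lt_inv_mul_iff₀ (scale_pos n),
    mul_one] at hfloor

lemma dir_eq_of_cell_eq (h : cell n s = cell n t) : dir n s = dir n t := by
  induction n with
  | zero => rfl
  | succ n ih => rw [dir, dir, ih (cell_eq_of_le h n.le_succ), turn, turn, h]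

lemma approx_sub_of_cell_eq (h : cell n s = cell n t) :
    approx n s - approx n t = (s - t : ℝ) * dir n t := by
  induction n with
  | zero => simp [approx, dir]
  | succ n ih =>
    have h' := cell_eq_of_le h n.le_succ
    have hoffset : (offset (n + 1) s : ℂ) = offset (n + 1) t + (s - t : ℝ) := by
      rw [offset, offset, h]
      push_cast
      ring
    rw [approx, approx, dir_eq_of_cell_eq h, dir_eq_of_cell_eq h', hoffset]
    linear_combination ih h'

lemma norm_zigzag_sub_sub_approx_sub_le (n : ℕ) (s t : ℝ) :
    ‖zigzag s - zigzag t - (approx n s - approx n t)‖ ≤ 2 * chord n / scale (n + 1) := by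
  rw [sub_sub_sub_comm]
  calc ‖zigzag s - approx n s - (zigzag t - approx n t)‖
      ≤ ‖zigzag s - approx n s‖ + ‖zigzag t - approx n t‖ := norm_sub_le _ _
    _ ≤ chord n / scale (n + 1) + chord n / scale (n + 1) :=
        add_le_add (norm_zigzag_sub_approx_le n s) (norm_zigzag_sub_approx_le n t)
    _ = 2 * chord n / scale (n + 1) := by ring

lemma norm_zigzag_sub_sub_le (h : cell n s = cell n t) :
    ‖zigzag s - zigzag t - (s - t : ℝ) * dir n t‖ ≤ 2 * chord n / scale (n + 1) := by
  rw [← approx_sub_of_cell_eq h]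
  exact norm_zigzag_sub_sub_approx_sub_le n s t

lemma norm_zigzag_sub_le (h : cell n s = cell n t) : ‖zigzag s - zigzag t‖ ≤ 3 / scale n := by
  have hsegment : ‖((s - t : ℝ) : ℂ) * dir n t‖ ≤ 1 / scale n := by
    rw [norm_mul, norm_dir, mul_one, Complex.norm_real, one_div]
    exact (abs_sub_lt_of_cell_eq h).le
  have herror : 2 * chord n / scale (n + 1) ≤ 2 / scale n := by
    have hscale : 2 * (scale n : ℝ) ≤ scale (n + 1) := by simpa using two_pow_mul_scale_le n 1
    have hpos := scale_pos n
    exact div_le_div₀ zero_le_two (by linarith [chord_le_one n]) hpos (by linarith)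
  calc ‖zigzag s - zigzag t‖
      ≤ ‖zigzag s - zigzag t - (s - t : ℝ) * dir n t‖ + ‖((s - t : ℝ) : ℂ) * dir n t‖ :=
        norm_le_norm_sub_add _ _
    _ ≤ 2 / scale n + 1 / scale n :=
        add_le_add ((norm_zigzag_sub_sub_le h).trans herror) hsegment
    _ = 3 / scale n := by ring

lemma offset_sub_le (h : t ≤ s) : offset n s - offset n t ≤ s - t := by
  have hcell : ((cell n t : ℝ) + 1 / 2) / scale n ≤ (cell n s + 1 / 2) / scale n := by
    gcongr
    exact cell_mono n h
  unfold offset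
  linarith

lemma cosTurn_mul_abs_sub_le (n : ℕ) (s t : ℝ) :
    cosTurn n * |s - t| ≤
      |s - t - (1 - cosTurn n) * (offset (n + 1) s - offset (n + 1) t)| := by
  wlog hst : t ≤ s generalizing s t
  · rw [abs_sub_comm s]
    refine (this t s (not_le.1 hst).le).trans_eq ?_
    rw [← abs_neg]
    ring_nf
  rw [abs_of_nonneg (sub_nonneg.2 hst)]
  refine le_trans ?_ (le_abs_self _)
  have hcos : 0 ≤ 1 - cosTurn n := sub_nonneg.2 (cosTurn_le_one n)
  linarith [mul_le_mul_of_nonneg_left (offset_sub_le (n := n + 1) hst) hcos]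

lemma abs_neg_one_zpow_cell_mul_offset_sub_le (n : ℕ) (s t : ℝ) :
    |(-1) ^ cell n s * offset n s - (-1) ^ cell n t * offset n t| ≤ |s - t| := by
  have hwave := abs_neg_one_zpow_floor_mul_sub_le (scale n * s) (scale n * t)
  rw [← mul_sub, abs_mul, abs_of_pos (scale_pos n)] at hwave
  rw [offset_eq, offset_eq, ← mul_div_assoc, ← mul_div_assoc, ← sub_div, abs_div,
    abs_of_pos (scale_pos n), div_le_iff₀' (scale_pos n)]
  exact hwave

lemma approx_succ_sub_div_dir (h : cell n s = cell n t) :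
    (approx (n + 1) s - approx (n + 1) t) / dir n t =
      ⟨s - t - (1 - cosTurn n) * (offset (n + 1) s - offset (n + 1) t),
        sinTurn n * ((-1) ^ cell (n + 1) s * offset (n + 1) s -
          (-1) ^ cell (n + 1) t * offset (n + 1) t)⟩ := by
  have hsub : approx (n + 1) s - approx (n + 1) t = dir n t * ((s - t : ℝ) +
      (offset (n + 1) s * (turn n s - 1) - offset (n + 1) t * (turn n t - 1))) := by
    simp only [approx, dir, dir_eq_of_cell_eq h]
    linear_combination approx_sub_of_cell_eq h
  rw [hsub, mul_div_cancel_left₀ _ (dir_ne_zero n t)]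
  apply Complex.ext <;> simp [turn] <;> ring

lemma mem_Ico_of_cell_eq {j : ℤ} (h : cell n t = j) : (j : ℝ) ≤ scale n * t ∧ scale n * t < j + 1 :=
  Int.floor_eq_iff.1 h

lemma cell_zero_of_mem (ht : t ∈ params) : cell 0 t = 0 := by
  have ht1 : t ≠ 1 := by
    rintro rfl
    simpa [scale_zero, (gap_pos 0).not_ge] using ht.2 0 1
  simpa [cell, scale_zero, Int.floor_eq_zero_iff] using ⟨ht.1.1, ht.1.2.lt_of_ne ht1⟩

lemma gap_div_scale_le (ht : t ∈ params) (h : cell n s ≠ cell n t) :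
    gap n / scale n ≤ |s - t| := by
  contrapose! h
  have hpos := scale_pos n
  have hlower := ht.2 n (cell n t)
  have hupper := ht.2 n (cell n t + 1)
  have hfloor := mem_Ico_of_cell_eq (n := n) (t := t) rfl
  rw [abs_of_nonneg (by linarith)] at hlower
  push_cast at hupper
  rw [abs_of_nonpos (by linarith)] at hupper
  rw [lt_div_iff₀ hpos, ← abs_of_pos hpos, ← abs_mul, sub_mul, abs_lt] at h
  rw [cell, Int.floor_eq_iff]
  constructor <;> linarith

lemma exists_last_common_cell (hs : s ∈ params) (ht : t ∈ params) (hst : s ≠ t) :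
    ∃ n, cell n s = cell n t ∧ cell (n + 1) s ≠ cell (n + 1) t := by
  by_contra! h
  have hcell (n : ℕ) : cell n s = cell n t := by
    induction n with
    | zero => rw [cell_zero_of_mem hs, cell_zero_of_mem ht]
    | succ n ih => exact h n ih
  have hle := ge_of_tendsto' tendsto_inv_scale fun n => (abs_sub_lt_of_cell_eq (hcell n)).le
  exact hst (sub_eq_zero.1 (abs_nonpos_iff.1 hle))

/-- In `params` the distance to points of other cells dominates the size of the next corrections,
as the number of subdivisions grows much faster than the gaps shrink. -/
lemma norm_zigzag_sub_sub_approx_succ_sub_le (ht : t ∈ params)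
    (h : cell (n + 1) s ≠ cell (n + 1) t) :
    ‖zigzag s - zigzag t - (approx (n + 1) s - approx (n + 1) t)‖ ≤ chord n / 4 * |s - t| := by
  have hscale : (scale (n + 2) : ℝ)⁻¹ ≤ 1 / 16 * |s - t| :=
    (inv_scale_add_two_le n).trans <| mul_le_mul (gap_le n) (gap_div_scale_le ht h)
      (div_nonneg (gap_pos _).le (scale_pos _).le) (by norm_num)
  have hchord : chord (n + 1) ≤ chord n := chord_antitone n.le_succ
  calc ‖zigzag s - zigzag t - (approx (n + 1) s - approx (n + 1) t)‖
      ≤ 2 * (chord (n + 1) * (scale (n + 2) : ℝ)⁻¹) :=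
        (norm_zigzag_sub_sub_approx_sub_le (n + 1) s t).trans_eq (by ring)
    _ ≤ 2 * (chord n * (1 / 16 * |s - t|)) := by
        gcongr
        exact chord_nonneg n
    _ ≤ chord n / 4 * |s - t| := by linarith [mul_nonneg (chord_nonneg n) (abs_nonneg (s - t))]

lemma norm_zigzag_sub_div_sub_le (ht : t ∈ params) (h : cell (n + 1) s ≠ cell (n + 1) t) :
    ‖(zigzag s - zigzag t) / dir n t - (approx (n + 1) s - approx (n + 1) t) / dir n t‖ ≤
      chord n / 4 * |s - t| := by
  rw [← sub_div, norm_div, norm_dir, div_one]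
  exact norm_zigzag_sub_sub_approx_succ_sub_le ht h

lemma abs_sub_le_abs_re (ht : t ∈ params) (h : cell n s = cell n t)
    (h' : cell (n + 1) s ≠ cell (n + 1) t) :
    |s - t| / 4 ≤ |((zigzag s - zigzag t) / dir n t).re| := by
  have herror := (Complex.abs_re_le_norm _).trans (norm_zigzag_sub_div_sub_le ht h')
  rw [Complex.sub_re, abs_sub_comm] at herror
  have happrox : cosTurn n * |s - t| ≤ |((approx (n + 1) s - approx (n + 1) t) / dir n t).re| := by
    rw [approx_succ_sub_div_dir h]
    exact cosTurn_mul_abs_sub_le n s t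
  have hcos := mul_le_mul_of_nonneg_right (half_le_cosTurn n) (abs_nonneg (s - t))
  have hchord := mul_le_mul_of_nonneg_right (chord_le_one n) (abs_nonneg (s - t))
  linarith [(abs_sub_abs_le_abs_sub _ _).trans herror]

lemma abs_im_le (ht : t ∈ params) (h : cell n s = cell n t)
    (h' : cell (n + 1) s ≠ cell (n + 1) t) :
    |((zigzag s - zigzag t) / dir n t).im| ≤ 2 * chord n * |s - t| := by
  have herror := (Complex.abs_im_le_norm _).trans (norm_zigzag_sub_div_sub_le ht h')
  rw [Complex.sub_im] at herror
  have happrox : |((approx (n + 1) s - approx (n + 1) t) / dir n t).im| ≤ chord n * |s - t| := by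
    rw [approx_succ_sub_div_dir h, abs_mul, abs_of_nonneg (sinTurn_nonneg n)]
    exact mul_le_mul (sinTurn_le_chord n) (abs_neg_one_zpow_cell_mul_offset_sub_le _ _ _)
      (abs_nonneg _) (chord_nonneg n)
  linarith [(abs_sub_abs_le_abs_sub _ _).trans herror,
    mul_nonneg (chord_nonneg n) (abs_nonneg (s - t))]

lemma abs_sub_le_norm_zigzag_sub (hs : s ∈ params) (ht : t ∈ params) :
    |s - t| ≤ 4 * ‖zigzag s - zigzag t‖ := by
  rcases eq_or_ne s t with rfl | hst
  · simp
  obtain ⟨n, h, h'⟩ := exists_last_common_cell hs ht hst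
  have hre := (abs_sub_le_abs_re ht h h').trans (Complex.abs_re_le_norm _)
  rw [norm_div, norm_dir, div_one] at hre
  linarith

lemma inner_dir (n : ℕ) (t : ℝ) (z : ℂ) : inner ℝ (dir n t) z = (z / dir n t).re := by
  rw [Complex.inner, div_eq_mul_inv, Complex.inv_eq_conj (norm_dir n t)]

/-- Distinct points of the limit set see each other nearly in the direction of their last common
segment. -/
lemma le_abs_inner_zigzag_sub (ht : t ∈ params) (h : cell n s = cell n t)
    (h' : cell (n + 1) s ≠ cell (n + 1) t) :
    (1 - 8 * chord n) * ‖zigzag s - zigzag t‖ ≤ |inner ℝ (dir n t) (zigzag s - zigzag t)| := by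
  set z := (zigzag s - zigzag t) / dir n t with hz
  have hnorm : ‖zigzag s - zigzag t‖ = ‖z‖ := by rw [hz, norm_div, norm_dir, div_one]
  have hst : |s - t| ≤ 4 * ‖z‖ := by
    linarith [abs_sub_le_abs_re ht h h', Complex.abs_re_le_norm z]
  have him : |z.im| ≤ 8 * chord n * ‖z‖ := by
    linarith [abs_im_le ht h h', mul_le_mul_of_nonneg_left hst (chord_nonneg n)]
  rw [inner_dir, hnorm]
  linarith [Complex.norm_le_abs_re_add_abs_im z]

lemma exists_lipschitz_leftInverse :
    ∃ h : ℂ → ℝ, LipschitzWith 4 h ∧ LeftInvOn h zigzag params := by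
  have hinj : InjOn zigzag params := fun s hs t ht hst => by
    simpa [hst, sub_eq_zero] using abs_sub_le_norm_zigzag_sub hs ht
  have hlip : LipschitzOnWith 4 (Function.invFunOn zigzag params) (zigzag '' params) := by
    refine LipschitzOnWith.of_dist_le_mul ?_
    rintro _ ⟨s, hs, rfl⟩ _ ⟨t, ht, rfl⟩
    rw [hinj.leftInvOn_invFunOn hs, hinj.leftInvOn_invFunOn ht, dist_eq_norm, dist_eq_norm]
    simpa using abs_sub_le_norm_zigzag_sub hs ht
  obtain ⟨h, hh, heq⟩ := hlip.extend_real
  exact ⟨h, hh, fun t ht =>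
    (heq (mem_image_of_mem _ ht)).symm.trans (hinj.leftInvOn_invFunOn ht)⟩

/-! ### The set of parameters -/

lemma isCompact_params : IsCompact params := by
  have hparams : params = Icc (0 : ℝ) 1 ∩ ⋂ (n : ℕ) (j : ℤ), {t | gap n ≤ |scale n * t - j|} := by
    ext t
    simp [params]
  rw [hparams]
  refine isCompact_Icc.inter_right (isClosed_iInter fun n => isClosed_iInter fun j => ?_)
  exact isClosed_le continuous_const (by fun_prop)

lemma continuousOn_zigzag : ContinuousOn zigzag params := by
  refine Metric.continuousOn_iff.2 fun t ht ε hε => ?_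
  have hsmall : ∀ᶠ n in atTop, 3 * (scale n : ℝ)⁻¹ < ε :=
    (tendsto_inv_scale.const_mul 3).eventually_lt_const (by simpa using hε)
  obtain ⟨n, hn⟩ := hsmall.exists
  refine ⟨gap n / scale n, div_pos (gap_pos n) (scale_pos n), fun s _ hst => ?_⟩
  have hcell : cell n s = cell n t := by
    contrapose! hst
    exact gap_div_scale_le ht hst
  rw [dist_eq_norm]
  exact (norm_zigzag_sub_le hcell).trans_lt hn

lemma setOf_near_grid_subset (n : ℕ) :
    {t : ℝ | t ∈ Icc (0 : ℝ) 1 ∧ ∃ j : ℤ, |scale n * t - j| < gap n} ⊆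
      ⋃ i ∈ Finset.range (scale n + 1), Metric.ball ((i : ℝ) / scale n) (gap n / scale n) := by
  have hpos := scale_pos n
  rintro t ⟨⟨ht0, ht1⟩, j, hj⟩
  have hgap : gap n < 1 := (gap_le n).trans_lt (by norm_num)
  have hlower : 0 ≤ scale n * t := by positivity
  have hupper : scale n * t ≤ scale n := mul_le_of_le_one_right hpos.le ht1
  have habs := abs_lt.1 hj
  have hj0 : -1 < j := by exact_mod_cast (by linarith : (-1 : ℝ) < j)
  have hj1 : j < scale n + 1 := by exact_mod_cast (by linarith : (j : ℝ) < scale n + 1)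
  lift j to ℕ using by omega
  refine mem_biUnion (x := j) (by simp; omega) ?_
  have hdist : t - j / scale n = (scale n * t - (j : ℤ)) / scale n := by
    field_simp
    simp
  rw [Metric.mem_ball, Real.dist_eq, hdist, abs_div, abs_of_pos hpos]
  gcongr

lemma volume_near_grid_le (n : ℕ) :
    volume {t : ℝ | t ∈ Icc (0 : ℝ) 1 ∧ ∃ j : ℤ, |scale n * t - j| < gap n} ≤
      ENNReal.ofReal (1 / 4 * (1 / 2) ^ n) := by
  have hpos := scale_pos n
  have hone : (1 : ℝ) ≤ scale n := (one_le_pow₀ one_le_two).trans (two_pow_le_scale n)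
  have hgap : (1 : ℝ) / 4 * (1 / 2) ^ n = 4 * gap n := by
    rw [gap, pow_add]
    ring
  refine (measure_mono (setOf_near_grid_subset n)).trans ((measure_biUnion_finset_le _ _).trans ?_)
  simp only [Real.volume_ball, Finset.sum_const, Finset.card_range, nsmul_eq_mul]
  rw [← ENNReal.ofReal_natCast, ← ENNReal.ofReal_mul (Nat.cast_nonneg _), hgap]
  refine ENNReal.ofReal_le_ofReal ?_
  push_cast
  rw [mul_div_assoc', mul_div_assoc', div_le_iff₀ hpos]
  nlinarith [mul_le_mul_of_nonneg_left hone (gap_pos n).le]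

lemma volume_params_pos : 0 < volume params := by
  set N : ℕ → Set ℝ := fun n => {t | t ∈ Icc (0 : ℝ) 1 ∧ ∃ j : ℤ, |scale n * t - j| < gap n}
  have hsub : Icc (0 : ℝ) 1 ⊆ params ∪ ⋃ n, N n := by
    intro t ht
    by_cases htp : t ∈ params
    · exact Or.inl htp
    · simp only [params, mem_ofPred_eq, ht, true_and, not_forall, not_le] at htp
      obtain ⟨n, j, hj⟩ := htp
      exact Or.inr (mem_iUnion.2 ⟨n, ht, j, hj⟩)
  have hsum : HasSum (fun n : ℕ => (1 : ℝ) / 4 * (1 / 2) ^ n) (1 / 4 * 2) :=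
    hasSum_geometric_two.mul_left _
  have hN : volume (⋃ n, N n) ≤ ENNReal.ofReal (1 / 4 * 2) := by
    rw [← hsum.tsum_eq, ENNReal.ofReal_tsum_of_nonneg (fun n => by positivity) hsum.summable]
    exact (measure_iUnion_le _).trans (ENNReal.tsum_le_tsum volume_near_grid_le)
  by_contra! h0
  have hle : volume (Icc (0 : ℝ) 1) ≤ ENNReal.ofReal (1 / 4 * 2) := by
    refine (measure_mono hsub).trans ((measure_union_le _ _).trans ?_)
    rw [nonpos_iff_eq_zero.1 h0, zero_add]
    exact hN
  rw [Real.volume_Icc, ENNReal.ofReal_le_ofReal_iff (by norm_num)] at hle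
  norm_num at hle

/-! ### Hausdorff measure of the curve -/

lemma measurable_cell (n : ℕ) : Measurable (cell n) :=
  Int.measurable_floor.comp (measurable_const_mul _)

lemma preimage_cell_singleton (n : ℕ) (j : ℤ) :
    cell n ⁻¹' {j} = Ico ((j : ℝ) / scale n) ((j + 1) / scale n) := by
  ext t
  rw [mem_preimage, mem_singleton_iff, cell, Int.floor_eq_iff, mem_Ico, div_le_iff₀' (scale_pos n),
    lt_div_iff₀' (scale_pos n)]

lemma volume_preimage_cell (n : ℕ) (j : ℤ) :
    volume (cell n ⁻¹' {j}) = ENNReal.ofReal (scale n)⁻¹ := by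
  rw [preimage_cell_singleton, Real.volume_Ico, ← sub_div, add_sub_cancel_left, one_div]

lemma ediam_zigzag_image_preimage_cell_le (n : ℕ) (j : ℤ) :
    Metric.ediam (zigzag '' (cell n ⁻¹' {j})) ≤ 3 * volume (cell n ⁻¹' {j}) := by
  refine Metric.ediam_le ?_
  rintro _ ⟨s, hs, rfl⟩ _ ⟨t, ht, rfl⟩
  rw [volume_preimage_cell, ← ENNReal.ofReal_ofNat 3, ← ENNReal.ofReal_mul zero_le_three,
    ← div_eq_mul_inv, edist_dist, dist_eq_norm]
  exact ENNReal.ofReal_le_ofReal (norm_zigzag_sub_le (Eq.trans hs (Eq.symm ht)))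

lemma preimage_cell_image_preimage (h : n ≤ m) (J : Set ℤ) :
    cell m ⁻¹' (cell m '' (cell n ⁻¹' J)) = cell n ⁻¹' J := by
  refine Subset.antisymm ?_ (subset_preimage_image _ _)
  rintro s ⟨t, ht, hts⟩
  rwa [mem_preimage, ← cell_eq_of_le hts h]

lemma hausdorffMeasure_zigzag_image_preimage_cell_le (n : ℕ) (J : Set ℤ) :
    μH[1] (zigzag '' (cell n ⁻¹' J)) ≤ 3 * volume (cell n ⁻¹' J) := by
  have hdiam : Tendsto (fun m => 3 * ENNReal.ofReal (scale m : ℝ)⁻¹) atTop (𝓝 0) := by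
    have := ENNReal.Tendsto.const_mul (ENNReal.tendsto_ofReal tendsto_inv_scale)
      (Or.inr (ENNReal.ofNat_ne_top (n := 3)))
    rwa [ENNReal.ofReal_zero, mul_zero] at this
  refine (Measure.hausdorffMeasure_le_liminf_tsum (ι := fun m => cell m '' (cell n ⁻¹' J)) 1 _ _
    hdiam (fun m j => zigzag '' (cell m ⁻¹' {j.1})) (Eventually.of_forall fun m j => ?_)
    (Eventually.of_forall fun m => ?_)).trans
    (liminf_le_of_frequently_le' ((eventually_ge_atTop n).mono fun m hm => ?_).frequently)
  · exact (ediam_zigzag_image_preimage_cell_le m j).trans_eq (by rw [volume_preimage_cell])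
  · rintro _ ⟨t, ht, rfl⟩
    exact mem_iUnion.2 ⟨⟨cell m t, mem_image_of_mem _ ht⟩, mem_image_of_mem _ rfl⟩
  calc ∑' j : cell m '' (cell n ⁻¹' J), Metric.ediam (zigzag '' (cell m ⁻¹' {j.1})) ^ (1 : ℝ)
      ≤ ∑' j : cell m '' (cell n ⁻¹' J), 3 * volume (cell m ⁻¹' {j.1}) :=
        ENNReal.tsum_le_tsum fun j => by
          rw [ENNReal.rpow_one]
          exact ediam_zigzag_image_preimage_cell_le m j
    _ = 3 * volume (cell n ⁻¹' J) := by
        rw [ENNReal.tsum_mul_left, tsum_measure_preimage_singleton (to_countable _) fun j _ =>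
          measurable_cell m (measurableSet_singleton j), preimage_cell_image_preimage hm]

lemma hausdorffMeasure_zigzag_image_le_of_isOpen {U : Set ℝ} (hU : IsOpen U) :
    μH[1] (zigzag '' U) ≤ 3 * volume U := by
  set J : ℕ → Set ℤ := fun n => {j | cell n ⁻¹' {j} ⊆ U}
  have hsub (n : ℕ) : cell n ⁻¹' J n ⊆ U := fun t ht => ht rfl
  have hmono : Monotone fun n => zigzag '' (cell n ⁻¹' J n) := fun m n hmn =>
    image_mono fun t ht s hs => ht (cell_eq_of_le hs hmn)
  have hcover : U = ⋃ n, cell n ⁻¹' J n := by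
    refine Subset.antisymm (fun t ht => ?_) (iUnion_subset hsub)
    obtain ⟨ε, hε, hball⟩ := Metric.isOpen_iff.1 hU t ht
    obtain ⟨n, hn⟩ := (tendsto_inv_scale.eventually_lt_const hε).exists
    exact mem_iUnion.2 ⟨n, fun s hs => hball ((abs_sub_lt_of_cell_eq hs).trans hn)⟩
  calc μH[1] (zigzag '' U) = ⨆ n, μH[1] (zigzag '' (cell n ⁻¹' J n)) := by
        rw [← hmono.measure_iUnion, ← image_iUnion, ← hcover]
    _ ≤ 3 * volume U := iSup_le fun n =>
        (hausdorffMeasure_zigzag_image_preimage_cell_le n (J n)).trans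
          (mul_le_mul_right (measure_mono (hsub n)) 3)

lemma hausdorffMeasure_zigzag_image_le (Z : Set ℝ) : μH[1] (zigzag '' Z) ≤ 3 * volume Z := by
  simp only [Z.measure_eq_iInf_isOpen volume, ENNReal.mul_iInf_of_ne three_ne_zero
    ENNReal.ofNat_ne_top]
  exact le_iInf₂ fun U hZU => le_iInf fun hU =>
    (measure_mono (image_mono hZU)).trans (hausdorffMeasure_zigzag_image_le_of_isOpen hU)

/-- The identification of the complex plane with the Euclidean plane. -/
noncomputable def toPlane : ℂ ≃ₗᵢ[ℝ] EuclideanSpace ℝ (Fin 2) :=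
  Complex.orthonormalBasisOneI.repr

/-- The compact set of the theorem: the part of the limit curve over `params`, where the
parametrization has a Lipschitz inverse. -/
def flatSet : Set (EuclideanSpace ℝ (Fin 2)) := toPlane '' (zigzag '' params)

lemma isCompact_flatSet : IsCompact flatSet :=
  (isCompact_params.image_of_continuousOn continuousOn_zigzag).image toPlane.continuous

lemma hausdorffMeasure_flatSet : μH[1] flatSet = μH[1] (zigzag '' params) :=
  toPlane.isometry.hausdorffMeasure_image (Or.inl zero_le_one) _

lemma hausdorffMeasure_flatSet_lt_top : μH[1] flatSet < ⊤ := by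
  rw [hausdorffMeasure_flatSet]
  exact (hausdorffMeasure_zigzag_image_le params).trans_lt
    (ENNReal.mul_lt_top ENNReal.ofNat_lt_top isCompact_params.measure_lt_top)

lemma hausdorffMeasure_flatSet_pos : 0 < μH[1] flatSet := by
  obtain ⟨h, hh, hleft⟩ := exists_lipschitz_leftInverse
  have himage := hh.hausdorffMeasure_image_le zero_le_one (zigzag '' params)
  rw [hleft.image_image, hausdorffMeasure_real, ← hausdorffMeasure_flatSet] at himage
  contrapose! himage
  rw [nonpos_iff_eq_zero.1 himage, mul_zero]
  exact volume_params_pos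

/-! ### Divergence of the directions -/

lemma preimage_cell_eq_biUnion (n : ℕ) (j : ℤ) :
    cell n ⁻¹' {j} = ⋃ i ∈ Finset.range (8 ^ (2 * n + 1)),
      cell (n + 1) ⁻¹' {j * (8 ^ (2 * n + 1) : ℕ) + i} := by
  set N := 8 ^ (2 * n + 1) with hN
  have hN0 : (0 : ℤ) < N := by positivity
  ext t
  simp only [mem_preimage, mem_singleton_iff, mem_iUnion, Finset.mem_range, exists_prop,
    cell_eq_ediv n t, ← hN]
  constructor
  · rintro rfl
    have hmod := Int.emod_nonneg (cell (n + 1) t) hN0.ne'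
    have hlt := Int.emod_lt_of_pos (cell (n + 1) t) hN0
    refine ⟨(cell (n + 1) t % N).toNat, by omega, ?_⟩
    rw [Int.toNat_of_nonneg hmod, Int.ediv_mul_add_emod]
  · rintro ⟨i, hi, hcell⟩
    rw [hcell, add_comm, Int.add_mul_ediv_right _ _ hN0.ne',
      Int.ediv_eq_zero_of_lt i.cast_nonneg (by exact_mod_cast hi), zero_add]

/-- The alternating rotations cancel up to their common cosine. -/
lemma sum_turn_eq {N : ℕ} (hN : Even N) (n : ℕ) (j : ℤ) {p : ℕ → ℝ}
    (hp : ∀ i, cell (n + 1) (p i) = j + i) :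
    ∑ i ∈ Finset.range N, turn n (p i) = N * cosTurn n := by
  have hsign (i : ℕ) : (-1 : ℝ) ^ (j + i) = (-1) ^ j * (-1) ^ i := by
    rw [zpow_add₀ (neg_ne_zero.2 one_ne_zero), zpow_natCast]
  apply Complex.ext
  · simp [turn]
  · simp [turn, hp, hsign, ← Finset.sum_mul, ← Finset.mul_sum, neg_one_geom_sum, hN]

lemma measurable_dir (n : ℕ) : Measurable (dir n) := by
  induction n with
  | zero => exact measurable_const
  | succ n ih =>
    have hturn : Measurable fun j : ℤ => (⟨cosTurn n, (-1) ^ j * sinTurn n⟩ : ℂ) :=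
      Measurable.of_discrete
    exact ih.mul (hturn.comp (measurable_cell (n + 1)))

lemma integrableOn_dir (m n : ℕ) (j : ℤ) : IntegrableOn (dir m) (cell n ⁻¹' {j}) :=
  Measure.integrableOn_of_bounded (M := 1)
    (by rw [volume_preimage_cell]; exact ENNReal.ofReal_ne_top)
    (measurable_dir m).aestronglyMeasurable (Eventually.of_forall fun t => (norm_dir m t).le)

lemma volume_real_preimage_cell (n : ℕ) (j : ℤ) :
    volume.real (cell n ⁻¹' {j}) = (scale n : ℝ)⁻¹ := by
  rw [measureReal_def, volume_preimage_cell, ENNReal.toReal_ofReal (inv_pos.2 (scale_pos n)).le]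

lemma measurableSet_preimage_cell (n : ℕ) (J : Set ℤ) : MeasurableSet (cell n ⁻¹' J) :=
  measurable_cell n (MeasurableSet.of_discrete)

lemma setIntegral_dir_self (n : ℕ) (t : ℝ) :
    ∫ s in cell n ⁻¹' {cell n t}, dir n s = (scale n : ℝ)⁻¹ • dir n t := by
  have heq : EqOn (dir n) (fun _ => dir n t) (cell n ⁻¹' {cell n t}) := fun s hs =>
    dir_eq_of_cell_eq hs
  rw [setIntegral_congr_fun (measurableSet_preimage_cell n _) heq, setIntegral_const,
    volume_real_preimage_cell]

lemma setIntegral_preimage_cell_eq_sum {j : ℤ} {f : ℝ → ℂ}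
    (hf : IntegrableOn f (cell n ⁻¹' {j})) :
    ∫ s in cell n ⁻¹' {j}, f s = ∑ i ∈ Finset.range (8 ^ (2 * n + 1)),
      ∫ s in cell (n + 1) ⁻¹' {j * (8 ^ (2 * n + 1) : ℕ) + i}, f s := by
  rw [preimage_cell_eq_biUnion] at hf ⊢
  refine integral_biUnion_finset _ (fun i _ => measurableSet_preimage_cell _ _) ?_
    fun i hi => hf.mono_set fun s hs => mem_biUnion hi hs
  exact fun a _ b _ hab => (disjoint_singleton.2 (by simpa using hab)).preimage _

lemma cell_surjective (n : ℕ) : Function.Surjective (cell n) := fun j =>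
  ⟨j / scale n, by rw [cell, mul_div_cancel₀ _ (scale_pos n).ne', Int.floor_intCast]⟩

/-- The quotient is the product of the cosines of the turning angles between the generations `n`
and `n + d`. -/
lemma setIntegral_dir (n d : ℕ) (t : ℝ) :
    ∫ s in cell n ⁻¹' {cell n t}, dir (n + d) s =
      ((n + 1) / (n + d + 1) * (scale n : ℝ)⁻¹) • dir n t := by
  induction d generalizing n t with
  | zero =>
    have : (n : ℝ) + 1 ≠ 0 := by positivity
    simpa [this] using setIntegral_dir_self n t
  | succ d ih =>
    set N := 8 ^ (2 * n + 1) with hN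
    choose p hp using fun i : ℕ => cell_surjective (n + 1) (cell n t * N + i)
    have hcell : ∀ i ∈ Finset.range N, cell n (p i) = cell n t := fun i hi => by
      have hmem : p i ∈ cell n ⁻¹' {cell n t} := by
        rw [preimage_cell_eq_biUnion]
        exact mem_biUnion hi (hp i)
      exact hmem
    calc ∫ s in cell n ⁻¹' {cell n t}, dir (n + (d + 1)) s
        = ∑ i ∈ Finset.range N,
            ∫ s in cell (n + 1) ⁻¹' {cell (n + 1) (p i)}, dir (n + 1 + d) s := by
          simp only [hp, add_right_comm n 1 d, add_assoc n d 1]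
          exact setIntegral_preimage_cell_eq_sum (integrableOn_dir _ _ _)
      _ = ∑ i ∈ Finset.range N, (((n + 2) / (n + d + 2) * (scale (n + 1) : ℝ)⁻¹ : ℝ) : ℂ) *
            dir n t * turn n (p i) := Finset.sum_congr rfl fun i hi => by
          rw [ih, dir, dir_eq_of_cell_eq (hcell i hi), Complex.real_smul, mul_assoc]
          push_cast
          ring
      _ = ((n + 1) / (n + (d + 1 : ℕ) + 1) * (scale n : ℝ)⁻¹) • dir n t := by
          have hscale := scale_pos n
          have hNpos : (0 : ℝ) < N := by positivity
          rw [← Finset.mul_sum, sum_turn_eq (by simp [hN, parity_simps]) n _ hp, scale_succ, ← hN,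
            Complex.real_smul, mul_right_comm]
          congr 1
          norm_cast
          rw [cosTurn]
          push_cast
          field_simp
          ring

lemma closedBall_ae_eq_preimage_cell (n : ℕ) (j : ℤ) :
    Metric.closedBall (((j : ℝ) + 1 / 2) / scale n) (1 / 2 / scale n) =ᵐ[volume]
      cell n ⁻¹' {j} := by
  have hball : Metric.closedBall (((j : ℝ) + 1 / 2) / scale n) (1 / 2 / scale n) =
      Icc ((j : ℝ) / scale n) ((j + 1) / scale n) := by
    rw [Real.closedBall_eq_Icc, ← sub_div, ← add_div, add_sub_cancel_right, add_assoc, add_halves]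
  rw [hball, preimage_cell_singleton]
  exact Ico_ae_eq_Icc.symm

lemma ae_eventually_lt_volume_inter_cell (T : Set ℝ) {c : ℝ} (hc : c < 1) :
    ∀ᵐ t ∂volume.restrict T, ∀ᶠ n in atTop,
      c * (scale n : ℝ)⁻¹ < volume.real (T ∩ cell n ⁻¹' {cell n t}) := by
  have hradius : Tendsto (fun n => 1 / 2 / (scale n : ℝ)) atTop (𝓝[>] 0) := by
    refine tendsto_nhdsWithin_iff.2 ⟨?_, Eventually.of_forall fun n => ?_⟩
    · have hmul := tendsto_inv_scale.const_mul (1 / 2)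
      rwa [mul_zero] at hmul
    · exact div_pos one_half_pos (scale_pos n)
  filter_upwards [IsUnifLocDoublingMeasure.ae_tendsto_measure_inter_div volume T 1] with t ht
  have hmem (n : ℕ) :
      t ∈ Metric.closedBall (((cell n t : ℝ) + 1 / 2) / scale n) (1 * (1 / 2 / scale n)) := by
    rw [one_mul, Metric.mem_closedBall, Real.dist_eq]
    exact abs_offset_le n t
  have hdensity := ht _ _ hradius (Eventually.of_forall hmem)
  have hreal := (ENNReal.tendsto_toReal ENNReal.one_ne_top).comp hdensity
  filter_upwards [hreal.eventually_const_lt hc] with n hn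
  rwa [Function.comp_apply, ENNReal.toReal_div,
    measure_congr ((ae_eq_refl T).inter (closedBall_ae_eq_preimage_cell n (cell n t))),
    measure_congr (closedBall_ae_eq_preimage_cell n (cell n t)), ← measureReal_def,
    ← measureReal_def, volume_real_preimage_cell, lt_div_iff₀ (inv_pos.2 (scale_pos n))] at hn

/-- At a density point of this set, the mean over a cell of generation `n` of the directions of
a much later generation would be close to `dir n₀ t`, while it is close to zero. -/
lemma volume_setOf_forall_norm_dir_sub_le (n₀ : ℕ) :
    volume {t | ∀ m ≥ n₀, ‖dir m t - dir n₀ t‖ ≤ 1 / 2} = 0 := by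
  set S := {t | ∀ m ≥ n₀, ‖dir m t - dir n₀ t‖ ≤ 1 / 2} with hS
  have hmeas : MeasurableSet S := by
    simp only [hS, ofPred_forall]
    exact .iInter fun m => .iInter fun _ => measurableSet_le
      ((measurable_dir m).sub (measurable_dir n₀)).norm measurable_const
  by_contra hpos
  obtain ⟨t, -, hdensity⟩ := Measure.exists_mem_of_measure_ne_zero_of_ae hpos
    (ae_eventually_lt_volume_inter_cell S (by norm_num : (9 / 10 : ℝ) < 1))
  obtain ⟨n, hlt, hn⟩ := (hdensity.and (eventually_ge_atTop n₀)).exists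
  set I := cell n ⁻¹' {cell n t}
  set m := n + 9 * (n + 1)
  have hvol : volume.real I = (scale n : ℝ)⁻¹ := volume_real_preimage_cell _ _
  have hI : volume I ≠ ⊤ := (volume_preimage_cell n _).trans_ne ENNReal.ofReal_ne_top
  have hinitial (s : ℝ) (hs : s ∈ I) : dir n₀ s = dir n₀ t :=
    dir_eq_of_cell_eq (cell_eq_of_le hs hn)
  have hupper : ‖∫ s in I, (dir m s - dir n₀ t)‖ ≤
      1 / 2 * volume.real (I ∩ S) + 2 * volume.real (I \ S) := by
    refine norm_setIntegral_le_of_norm_le_of_norm_le hmeas hI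
      ((integrableOn_dir m n _).sub (integrableOn_const hI)) (fun s hs => ?_) fun s _ => ?_
    · rw [← hinitial s hs.1]
      exact hs.2 m (by omega)
    · refine (norm_sub_le _ _).trans_eq ?_
      rw [norm_dir, norm_dir, one_add_one_eq_two]
  have hmean : ‖∫ s in I, dir m s‖ = 1 / 10 * (scale n : ℝ)⁻¹ := by
    rw [setIntegral_dir, norm_smul, norm_dir, mul_one, Real.norm_of_nonneg (by positivity)]
    push_cast
    field_simp
    ring
  have hlower : (scale n : ℝ)⁻¹ - 1 / 10 * (scale n : ℝ)⁻¹ ≤ ‖∫ s in I, (dir m s - dir n₀ t)‖ := by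
    rw [integral_sub (integrableOn_dir m n _) (integrableOn_const hI), setIntegral_const, hvol,
      norm_sub_rev, ← hmean]
    refine le_trans (le_of_eq ?_) (norm_sub_norm_le _ _)
    rw [norm_smul, norm_dir, mul_one, Real.norm_of_nonneg (inv_pos.2 (scale_pos n)).le]
  have hadd := measureReal_inter_add_sdiff hmeas hI
  rw [inter_comm] at hlt
  linarith [inv_pos.2 (scale_pos n)]

lemma ae_not_tendsto_dir : ∀ᵐ t, ¬ ∃ w, Tendsto (fun n => dir n t) atTop (𝓝 w) := by
  refine measure_mono_null ?_ (measure_iUnion_null volume_setOf_forall_norm_dir_sub_le)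
  intro t ht
  obtain ⟨w, hw⟩ := not_not.1 ht
  obtain ⟨n₀, hn₀⟩ := Metric.cauchySeq_iff'.1 hw.cauchySeq (1 / 2) one_half_pos
  exact mem_iUnion.2 ⟨n₀, fun m hm => by simpa only [dist_eq_norm] using (hn₀ m hm).le⟩

/-! ### Pure unrectifiability -/

lemma exists_mem_cell_le_abs_sub {T : Set ℝ}
    (h : 1 / 2 * (scale n : ℝ)⁻¹ < volume.real (T ∩ cell n ⁻¹' {cell n t})) :
    ∃ q ∈ T, cell n q = cell n t ∧ (scale n : ℝ)⁻¹ / 4 ≤ |q - t| := by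
  contrapose! h
  have hsub : T ∩ cell n ⁻¹' {cell n t} ⊆ Metric.ball t ((scale n : ℝ)⁻¹ / 4) :=
    fun q hq => h q hq.1 hq.2
  refine (measureReal_mono hsub measure_ball_lt_top.ne).trans_eq ?_
  rw [Real.volume_real_ball (by positivity)]
  ring

lemma norm_slope_zigzag_sub_dir_le (h : cell n s = cell n t)
    (h' : (scale n : ℝ)⁻¹ / 4 ≤ |s - t|) : ‖slope zigzag t s - dir n t‖ ≤ 4 * chord n := by
  have hpos := scale_pos n
  have hscale : 2 * (scale n : ℝ) ≤ scale (n + 1) := by simpa using two_pow_mul_scale_le n 1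
  have hst : 0 < |s - t| := (by positivity : 0 < (scale n : ℝ)⁻¹ / 4).trans_le h'
  have hslope : slope zigzag t s - dir n t =
      (s - t)⁻¹ • (zigzag s - zigzag t - (s - t : ℝ) * dir n t) := by
    rw [smul_sub, ← Complex.real_smul, inv_smul_smul₀ (abs_pos.1 hst), slope, vsub_eq_sub]
  rw [hslope, norm_smul, norm_inv, Real.norm_eq_abs, inv_mul_le_iff₀ hst]
  calc ‖zigzag s - zigzag t - (s - t : ℝ) * dir n t‖
      ≤ 2 * chord n / scale (n + 1) := norm_zigzag_sub_sub_le h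
    _ ≤ 2 * chord n / (2 * scale n) := by
        gcongr
        exact mul_nonneg zero_le_two (chord_nonneg n)
    _ = 4 * chord n * ((scale n : ℝ)⁻¹ / 4) := by ring
    _ ≤ 4 * chord n * |s - t| := by
        gcongr
        exact mul_nonneg zero_le_four (chord_nonneg n)
    _ = |s - t| * (4 * chord n) := mul_comm _ _

lemma tendsto_dir_of_hasDerivAt {F : ℝ → ℂ} {T : Set ℝ} {w : ℂ} (hF : EqOn zigzag F T)
    (ht : t ∈ T) (hw : HasDerivAt F w t)
    (hdensity : ∀ᶠ n in atTop, 1 / 2 * (scale n : ℝ)⁻¹ < volume.real (T ∩ cell n ⁻¹' {cell n t})) :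
    Tendsto (fun n => dir n t) atTop (𝓝 w) := by
  obtain ⟨q, hq⟩ := (hdensity.mono fun n hn => exists_mem_cell_le_abs_sub hn).choice
  have hqt : Tendsto q atTop (𝓝[≠] t) := by
    refine tendsto_nhdsWithin_iff.2 ⟨tendsto_iff_dist_tendsto_zero.2 ?_, ?_⟩
    · refine squeeze_zero' (Eventually.of_forall fun n => dist_nonneg) ?_ tendsto_inv_scale
      exact hq.mono fun n hn => (abs_sub_lt_of_cell_eq hn.2.1).le
    · refine hq.mono fun n hn => sub_ne_zero.1 (abs_pos.1 (lt_of_lt_of_le ?_ hn.2.2))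
      exact div_pos (inv_pos.2 (scale_pos n)) four_pos
  have hslope : Tendsto (fun n => slope F t (q n)) atTop (𝓝 w) :=
    (hasDerivAt_iff_tendsto_slope.1 hw).comp hqt
  have herror : Tendsto (fun n => slope F t (q n) - dir n t) atTop (𝓝 0) := by
    refine squeeze_zero_norm' (hq.mono fun n hn => ?_) (by simpa using tendsto_chord.const_mul 4)
    rw [slope, ← hF hn.1, ← hF ht]
    exact norm_slope_zigzag_sub_dir_le hn.2.1 hn.2.2
  simpa using hslope.sub herror

lemma volume_eq_zero_of_lipschitzOnWith_zigzag {T : Set ℝ} {K : NNReal}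
    (h : LipschitzOnWith K zigzag T) : volume T = 0 := by
  obtain ⟨F, hF, hFT⟩ := h.extend_finite_dimension
  by_contra hT
  obtain ⟨t, ht, hdensity, hdiff, hdiv⟩ := Measure.exists_mem_of_measure_ne_zero_of_ae hT
    ((ae_eventually_lt_volume_inter_cell T one_half_lt_one).and
      (ae_restrict_of_ae (hF.ae_differentiableAt.and ae_not_tendsto_dir)))
  exact hdiv ⟨_, tendsto_dir_of_hasDerivAt hFT ht hdiff.hasDerivAt hdensity⟩

lemma hausdorffMeasure_zigzag_image_inter_range_eq_zero {g : ℝ → ℂ} {C : NNReal}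
    (hg : LipschitzWith C g) : μH[1] (zigzag '' params ∩ range g) = 0 := by
  obtain ⟨h, hh, hleft⟩ := exists_lipschitz_leftInverse
  have hnull (Z : Set ℝ) (hZ : μH[Module.finrank ℝ ℝ] Z = 0) :
      μH[Module.finrank ℝ ℝ] (zigzag '' Z) = 0 := by
    rw [Module.finrank_self, Nat.cast_one] at hZ ⊢
    rw [hausdorffMeasure_real] at hZ
    simpa [hZ] using hausdorffMeasure_zigzag_image_le Z
  have hlip (T : Set ℝ) (K : NNReal) (hT : LipschitzOnWith K zigzag T) :
      μH[Module.finrank ℝ ℝ] T = 0 := by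
    rw [Module.finrank_self, Nat.cast_one, hausdorffMeasure_real]
    exact volume_eq_zero_of_lipschitzOnWith_zigzag hT
  simpa using hausdorffMeasure_image_inter_range_eq_zero hh hleft hnull hlip hg

lemma isPurelyUnrectifiable_flatSet : IsPurelyUnrectifiable 1 flatSet := by
  refine isPurelyUnrectifiable_of_lipschitz_range fun f K hf => ?_
  set e := (OrthonormalBasis.singleton (Fin 1) ℝ).repr
  have hrange : range f = toPlane '' range (toPlane.symm ∘ f ∘ e) := by
    rw [← range_comp, ← Function.comp_assoc, LinearIsometryEquiv.self_comp_symm,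
      Function.id_comp, e.surjective.range_comp]
  rw [flatSet, hrange, ← image_inter toPlane.injective, Nat.cast_one,
    toPlane.isometry.hausdorffMeasure_image (Or.inl zero_le_one)]
  exact hausdorffMeasure_zigzag_image_inter_range_eq_zero
    (toPlane.symm.lipschitz.comp (hf.comp e.lipschitz))

/-! ### Cones -/

lemma eq_or_eq_add_one_of_last_common_cell (h : cell n s = cell n t)
    (h' : cell (n + 2) s ≠ cell (n + 2) t) (hm : cell m s = cell m t)
    (hm' : cell (m + 1) s ≠ cell (m + 1) t) : m = n ∨ m = n + 1 := by
  have hle : n ≤ m := by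
    by_contra! hlt
    exact hm' (cell_eq_of_le h hlt)
  have hlt : m < n + 2 := by
    by_contra! hle
    exact h' (cell_eq_of_le hm hle)
  omega

lemma norm_dir_sub_dir_le (t : ℝ) (h : m = n ∨ m = n + 1) : ‖dir m t - dir n t‖ ≤ chord n := by
  rcases h with rfl | rfl
  · simpa using chord_nonneg m
  · exact (norm_dir_succ_sub n t).le

/-- The last common generation of `s` and `t` is `n` or `n + 1`, and the directions of these two
generations differ by `chord n`. -/
lemma le_abs_inner_zigzag_sub_of_cell_add_two_ne (hs : s ∈ params) (ht : t ∈ params)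
    (h : cell n s = cell n t) (h' : cell (n + 2) s ≠ cell (n + 2) t) :
    (1 - 9 * chord n) * ‖zigzag s - zigzag t‖ ≤ |inner ℝ (dir n t) (zigzag s - zigzag t)| := by
  have hst : s ≠ t := fun heq => h' (by rw [heq])
  obtain ⟨m, hm, hm'⟩ := exists_last_common_cell hs ht hst
  have hmn := eq_or_eq_add_one_of_last_common_cell h h' hm hm'
  set z := zigzag s - zigzag t
  have hlast : (1 - 8 * chord n) * ‖z‖ ≤ |inner ℝ (dir m t) z| := by
    refine le_trans ?_ (le_abs_inner_zigzag_sub ht hm hm')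
    gcongr
    exact chord_antitone (by omega)
  have hchange : |inner ℝ (dir m t) z - inner ℝ (dir n t) z| ≤ chord n * ‖z‖ := by
    rw [← inner_sub_left]
    exact (abs_real_inner_le_norm _ _).trans
      (mul_le_mul_of_nonneg_right (norm_dir_sub_dir_le t hmn) (norm_nonneg z))
  linarith [(abs_sub_abs_le_abs_sub _ _).trans hchange]

lemma flatSet_inter_cone_subset {r α : ℝ} (ht : t ∈ params) (hr : 4 * r < gap n / scale n)
    (hα : α ≤ 1 - 9 * chord n) :
    flatSet ∩ cone (toPlane (zigzag t)) r (ℝ ∙ toPlane (dir n t))ᗮ α ⊆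
      toPlane '' (zigzag '' (cell (n + 2) ⁻¹' {cell (n + 2) t})) := by
  rintro _ ⟨⟨_, ⟨s, hs, rfl⟩, rfl⟩, hball, hcone⟩
  refine mem_image_of_mem _ (mem_image_of_mem _ ?_)
  rw [Metric.mem_closedBall, toPlane.dist_map, dist_eq_norm] at hball
  rw [mem_ofPred_eq, ← map_sub, toPlane.norm_map] at hcone
  have hcell : cell n s = cell n t := by
    by_contra hne
    linarith [gap_div_scale_le ht hne, abs_sub_le_norm_zigzag_sub hs ht]
  by_contra hne
  have hdist := abs_inner_le_infDist_orthogonal (u := toPlane (dir n t))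
    (by rw [toPlane.norm_map, norm_dir]) (toPlane (zigzag s - zigzag t))
  rw [toPlane.inner_map_map] at hdist
  linarith [le_abs_inner_zigzag_sub_of_cell_add_two_ne hs ht hcell hne,
    mul_le_mul_of_nonneg_right hα (norm_nonneg (zigzag s - zigzag t))]

lemma infConeRatio_flatSet_le {r α : ℝ} (ht : t ∈ params)
    (hr : gap (n + 1) / scale (n + 1) ≤ 4 * r) (hr' : 4 * r < gap n / scale n)
    (hα : α ≤ 1 - 9 * chord n) :
    infConeRatio 1 flatSet α (toPlane (zigzag t)) r ≤ ENNReal.ofReal (6 * gap n) := by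
  have hline : (ℝ ∙ toPlane (dir n t))ᗮ ∈ linSubspaces 2 (2 - 1) :=
    orthogonal_span_singleton_mem_linSubspaces
      (toPlane.map_eq_zero_iff.not.2 (dir_ne_zero n t))
  have hscale : 3 * (scale (n + 2) : ℝ)⁻¹ ≤ 6 * gap n * (2 * r) := by
    linarith [inv_scale_add_two_le n, mul_le_mul_of_nonneg_left hr (gap_pos n).le]
  refine (iInf₂_le _ hline).trans ?_
  rw [Nat.cast_one, pow_one]
  refine ENNReal.div_le_of_le_mul ?_
  calc μH[1] (flatSet ∩ cone (toPlane (zigzag t)) r (ℝ ∙ toPlane (dir n t))ᗮ α)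
      ≤ μH[1] (toPlane '' (zigzag '' (cell (n + 2) ⁻¹' {cell (n + 2) t}))) :=
        measure_mono (flatSet_inter_cone_subset ht hr' hα)
    _ ≤ 3 * volume (cell (n + 2) ⁻¹' {cell (n + 2) t}) := by
        rw [toPlane.isometry.hausdorffMeasure_image (Or.inl zero_le_one)]
        exact hausdorffMeasure_zigzag_image_le _
    _ = ENNReal.ofReal (3 * (scale (n + 2) : ℝ)⁻¹) := by
        rw [volume_preimage_cell, ENNReal.ofReal_mul zero_le_three, ENNReal.ofReal_ofNat]
    _ ≤ ENNReal.ofReal (6 * gap n) * ENNReal.ofReal (2 * r) := by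
        rw [← ENNReal.ofReal_mul (mul_nonneg (by norm_num) (gap_pos n).le)]
        exact ENNReal.ofReal_le_ofReal hscale

lemma tendsto_gap : Tendsto gap atTop (𝓝 0) :=
  (tendsto_pow_atTop_nhds_zero_of_lt_one (by norm_num) (by norm_num)).comp
    (tendsto_add_atTop_nat 4)

lemma tendsto_infConeRatio_flatSet {α : ℝ} (hα : α < 1) {x : EuclideanSpace ℝ (Fin 2)}
    (hx : x ∈ flatSet) : Tendsto (fun r => infConeRatio 1 flatSet α x r) (𝓝[>] 0) (𝓝 0) := by
  obtain ⟨_, ⟨t, ht, rfl⟩, rfl⟩ := hx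
  refine ENNReal.tendsto_nhds_zero.2 fun ε hε => ?_
  have hbound : Tendsto (fun n => ENNReal.ofReal (6 * gap n)) atTop (𝓝 0) := by
    simpa using ENNReal.tendsto_ofReal (tendsto_gap.const_mul 6)
  have haperture : Tendsto (fun n => 1 - 9 * chord n) atTop (𝓝 1) := by
    simpa using (tendsto_chord.const_mul 9).const_sub 1
  have hradius : Tendsto (fun n => gap n / scale n) atTop (𝓝 0) := by
    simpa [div_eq_mul_inv] using tendsto_gap.mul tendsto_inv_scale
  obtain ⟨n₀, hn₀⟩ := eventually_atTop.1
    ((hbound.eventually_le_const hε).and (haperture.eventually_const_le hα))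
  have hpos : 0 < gap n₀ / scale n₀ / 4 :=
    div_pos (div_pos (gap_pos n₀) (scale_pos n₀)) four_pos
  filter_upwards [Ioo_mem_nhdsGT hpos] with r ⟨hr0, hr⟩
  obtain ⟨n, hn, hle, hlt⟩ := exists_succ_le_lt_of_tendsto_zero hradius (n₀ := n₀) (r := 4 * r)
    (by linarith) (by linarith)
  exact (infConeRatio_flatSet_le ht hle hlt (hn₀ n hn).2).trans (hn₀ n hn).1

end ZigzagCantor

theorem mainTheorem3 :
    ∃ A : Set (EuclideanSpace ℝ (Fin 2)),
      IsCompact A ∧ IsPurelyUnrectifiable 1 A ∧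
      0 < Measure.hausdorffMeasure (1 : ℝ) A ∧ Measure.hausdorffMeasure (1 : ℝ) A < ⊤ ∧
      (∀ α : ℝ, 0 < α → α < 1 → ∀ x ∈ A,
        Tendsto (fun r : ℝ => infConeRatio 1 A α x r) (𝓝[>] 0) (𝓝 0)) ∧
      (∀ α : ℝ, 0 < α → α < 1 → ∀ c : ENNReal, 0 < c →
        ¬ ∀ᵐ x ∂((Measure.hausdorffMeasure (1 : ℝ)).restrict A),
          c < limsup (fun r : ℝ => infConeRatio 1 A α x r) (𝓝[>] 0)) := by
  have hpos := ZigzagCantor.hausdorffMeasure_flatSet_pos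
  refine ⟨ZigzagCantor.flatSet, ZigzagCantor.isCompact_flatSet,
    ZigzagCantor.isPurelyUnrectifiable_flatSet, hpos,
    ZigzagCantor.hausdorffMeasure_flatSet_lt_top,
    fun α _ hα x hx => ZigzagCantor.tendsto_infConeRatio_flatSet hα hx, fun α _ hα c _ hae => ?_⟩
  obtain ⟨x, hx, hlimsup⟩ := Measure.exists_mem_of_measure_ne_zero_of_ae hpos.ne' hae
  rw [(ZigzagCantor.tendsto_infConeRatio_flatSet hα hx).limsup_eq] at hlimsup
  exact not_lt_zero hlimsup
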